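/- Theorem 2 (Zone theorem in three dimensions). Let $\mathcal A$ be a set of $n$ planes in $\mathbb R^3$ in general position: no two of the planes are parallel, any three of them meet in exactly one point, and no four of them have a common point. The cells of $\mathcal A$ are the connected components of $\mathbb R^3\setminus\bigcup_{P\in\mathcal A}P$, and the faces of $\mathcal A$ are, for each $P\in\mathcal A$, the connected components of $P\setminus\bigcup_{Q\in\mathcal A,\,Q\ne P}Q$. For a cell $C$, let $F_C$ be the set of faces of $\mathcal A$ contained in the boundary of $C$. Let $S$ be a plane in $\mathbb R^3$ that is not in $\mathcal A$, let $\mathrm{zone}(S)$ be the set of cells $C$ with $C\cap S\neq\emptyset$, and let $|\mathrm{zone}(S)|=\sum_{C\in\mathrm{zone}(S)}|F_C|$. Then $\mathrm{zone}(S)$ and all the sets $F_C$, $C\in\mathrm{zone}(S)$, are finite and $$|\mathrm{zone}(S)|=O(n^2),$$ that is, there is an absolute constant $c$ such that $|\mathrm{zone}(S)|\le c\,n^2$ for all $n$, all such $\mathcal A$ and all such $S$. -/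

import Mathlib

namespace PlaneArrangement

/-- Three-dimensional Euclidean space. -/
abbrev E3 : Type := EuclideanSpace ℝ (Fin 3)

/-- A plane in `ℝ³`: a two-dimensional affine subspace (the empty subspace has direction `⊥`, so a
plane is automatically nonempty). -/
def IsPlane (P : AffineSubspace ℝ E3) : Prop :=
  Module.finrank ℝ P.direction = 2

/-- General position: no two of the planes are parallel, any three of them meet in exactly one
point (in particular they share no line), and no four of them have a common point. -/
structure GeneralPosition (A : Finset (AffineSubspace ℝ E3)) : Prop where
  not_parallel : ∀ P ∈ A, ∀ Q ∈ A, P ≠ Q → ¬ P.Parallel Q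
  three : ∀ P ∈ A, ∀ Q ∈ A, ∀ R ∈ A, P ≠ Q → P ≠ R → Q ≠ R →
    ∃! x : E3, x ∈ P ∧ x ∈ Q ∧ x ∈ R
  four : ∀ P ∈ A, ∀ Q ∈ A, ∀ R ∈ A, ∀ T ∈ A,
    P ≠ Q → P ≠ R → P ≠ T → Q ≠ R → Q ≠ T → R ≠ T →
    ¬ ∃ x : E3, x ∈ P ∧ x ∈ Q ∧ x ∈ R ∧ x ∈ T

/-- The points of `ℝ³` that lie on no plane of the arrangement. -/
def complementSet (A : Finset (AffineSubspace ℝ E3)) : Set E3 :=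
  {x | ∀ P ∈ A, x ∉ P}

/-- The (open) cells: the connected components of the complement of the union of the planes. -/
def cells (A : Finset (AffineSubspace ℝ E3)) : Set (Set E3) :=
  {C | ∃ x ∈ complementSet A, C = connectedComponentIn (complementSet A) x}

/-- The points of `P` that lie on no other plane of the arrangement. -/
def planeComplement (A : Finset (AffineSubspace ℝ E3)) (P : AffineSubspace ℝ E3) : Set E3 :=
  {x | x ∈ P ∧ ∀ Q ∈ A, Q ≠ P → x ∉ Q}

/-- The (relatively open, two-dimensional) faces of the arrangement: the regions into which a plane
of the arrangement is divided by the other planes. -/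
def faces (A : Finset (AffineSubspace ℝ E3)) : Set (Set E3) :=
  {F | ∃ P ∈ A, ∃ x ∈ planeComplement A P, F = connectedComponentIn (planeComplement A P) x}

/-- The faces of the arrangement that lie on the boundary of `C`. -/
def facesOf (A : Finset (AffineSubspace ℝ E3)) (C : Set E3) : Set (Set E3) :=
  {F | F ∈ faces A ∧ F ⊆ frontier C}

/-- The zone of `S`: the cells of the arrangement that `S` intersects. -/
def zone (A : Finset (AffineSubspace ℝ E3)) (S : AffineSubspace ℝ E3) : Set (Set E3) :=
  {C | C ∈ cells A ∧ (C ∩ (S : Set E3)).Nonempty}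

/-- The size of the zone: the sum, over its cells, of the number of faces on their boundary. -/
noncomputable def zoneSize (A : Finset (AffineSubspace ℝ E3)) (S : AffineSubspace ℝ E3) : ℕ :=
  ∑ᶠ C ∈ zone A S, (facesOf A C).ncard

end PlaneArrangement

/-!
A cell is recorded by the set of hyperplanes on whose positive side it lies. Delete a hyperplane
`h` and consider the pairs of a zone cell and one of its facets outside `h`: two such pairs merge
only if `h` separates them, and then, by convexity, they come from a pair in the zone of `s ∩ h`
inside `h`. Averaging this inequality over all `h` bounds the zone of a `d`-dimensional `s` in a
`(d + 1)`-dimensional arrangement by the zones of `(d - 1)`-dimensional sections, and for `2 ≤ d`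
the recursion gives `O(n ^ d)`.

For a line `s` in a plane the average loses a logarithm. There one orients `s`, counts only the
edges that lie behind their cell, and deletes the last hyperplane `h` crossed by `s`: it carries at
most one of these edges, and the section by `h` costs at most `2`, so the count grows by at most
`3`. Reversing the orientation of `s` counts the remaining edges.
-/

open scoped Finset

namespace PlaneArrangement

section Counting

variable {ι : Type*} [DecidableEq ι]

/-- The map `σ ↦ σ.erase h` is at most two-to-one, and `𝒞` contains its double values. -/
lemma card_le_card_add_card_of_erase_of_insert {𝒜 ℬ 𝒞 : Finset (Finset ι)} (h : ι)
    (hℬ : ∀ σ ∈ 𝒜, σ.erase h ∈ ℬ)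
    (h𝒞 : ∀ σ ∈ 𝒜, h ∉ σ → insert h σ ∈ 𝒜 → σ ∈ 𝒞) : #𝒜 ≤ #ℬ + #𝒞 := by
  rw [← Finset.card_memberSubfamily_add_card_nonMemberSubfamily h 𝒜,
    ← Finset.card_union_add_card_inter]
  gcongr
  · intro σ hσ
    rw [Finset.mem_union, Finset.mem_memberSubfamily, Finset.mem_nonMemberSubfamily] at hσ
    rcases hσ with ⟨hmem, hh⟩ | ⟨hmem, hh⟩ <;> simpa [hh] using hℬ _ hmem
  · intro σ hσ
    rw [Finset.mem_inter, Finset.mem_memberSubfamily, Finset.mem_nonMemberSubfamily] at hσ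
    exact h𝒞 σ hσ.2.1 hσ.2.2 hσ.1.1

lemma sum_sum_erase {M : Type*} [AddCommMonoid M] (I : Finset ι) (g : ι → M) :
    ∑ h ∈ I, ∑ i ∈ I.erase h, g i = (#I - 1) • ∑ i ∈ I, g i := by
  rw [Finset.sum_comm' (t' := I) (s' := fun i => I.erase i) (by simp; tauto), Finset.smul_sum]
  exact Finset.sum_congr rfl fun i hi => by rw [Finset.sum_const, Finset.card_erase_of_mem hi]

end Counting

section AffineGeometry

variable {𝕜 E : Type*} [Field 𝕜] [AddCommGroup E] [Module 𝕜 E]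

lemma exists_affineMap_eq_zero_iff_mem [FiniteDimensional 𝕜 E] {P : AffineSubspace 𝕜 E}
    (hne : (P : Set E).Nonempty)
    (hP : Module.finrank 𝕜 P.direction + 1 = Module.finrank 𝕜 E) :
    ∃ g : E →ᵃ[𝕜] 𝕜, ∀ x, g x = 0 ↔ x ∈ P := by
  obtain ⟨p, hp⟩ := hne
  have hlt : P.direction < ⊤ := Submodule.lt_top_of_finrank_lt_finrank (by lia)
  obtain ⟨g, hg, hle⟩ := Submodule.exists_le_ker_of_lt_top _ hlt
  have hker : P.direction = LinearMap.ker g := by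
    refine Submodule.eq_of_le_of_finrank_eq hle ?_
    have := Module.Dual.finrank_ker_add_one_of_ne_zero hg
    lia
  refine ⟨g.toAffineMap - AffineMap.const 𝕜 E (g p), fun x => ?_⟩
  rw [← AffineSubspace.vsub_right_mem_direction_iff_mem hp, hker]
  simp

lemma finrank_vectorSpan_inter_preimage_zero_le [FiniteDimensional 𝕜 E] {s : Set E} {x : E} {d : ℕ}
    {g : E →ᵃ[𝕜] 𝕜} (hx : x ∈ s) (hgx : g x ≠ 0)
    (hd : Module.finrank 𝕜 (vectorSpan 𝕜 s) ≤ d + 1) :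
    Module.finrank 𝕜 (vectorSpan 𝕜 (s ∩ g ⁻¹' {0})) ≤ d := by
  rcases (s ∩ g ⁻¹' {0}).eq_empty_or_nonempty with hempty | ⟨y, hys, hy⟩
  · rw [hempty, vectorSpan_empty, finrank_bot]
    exact d.zero_le
  have hle : vectorSpan 𝕜 (s ∩ g ⁻¹' {0}) ≤ LinearMap.ker g.linear := by
    refine Submodule.span_le.2 ?_
    rintro _ ⟨a, ⟨-, ha : g a = 0⟩, b, ⟨-, hb : g b = 0⟩, rfl⟩
    change a -ᵥ b ∈ LinearMap.ker g.linear
    rw [LinearMap.mem_ker, AffineMap.linearMap_vsub, ha, hb, vsub_self]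
  have hxy : x -ᵥ y ∉ vectorSpan 𝕜 (s ∩ g ⁻¹' {0}) := fun h => hgx <| by
    simpa [-vsub_eq_sub, show g y = 0 from hy] using hle h
  have hlt : vectorSpan 𝕜 (s ∩ g ⁻¹' {0}) < vectorSpan 𝕜 s :=
    SetLike.lt_iff_le_and_exists.2 ⟨vectorSpan_mono 𝕜 Set.inter_subset_left,
      x -ᵥ y, vsub_mem_vectorSpan 𝕜 hx hys, hxy⟩
  have := Submodule.finrank_lt_finrank_of_lt hlt
  lia

lemma affineMap_smul_vadd_eq_mul (g : E →ᵃ[𝕜] 𝕜) {v : E} (hv : g.linear v ≠ 0) (t : 𝕜) (p : E) :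
    g (t • v +ᵥ p) = (t - -g p / g.linear v) * g.linear v := by
  rw [AffineMap.map_vadd, map_smul, smul_eq_mul, vadd_eq_add]
  field_simp
  ring

lemma subsingleton_inter_preimage_zero {g : E →ᵃ[𝕜] 𝕜} {v p : E} (hv : g.linear v ≠ 0) {s : Set E}
    (hs : ∀ x ∈ s, ∃ t : 𝕜, x = t • v +ᵥ p) : (s ∩ g ⁻¹' {0}).Subsingleton := by
  rintro x ⟨hx, hx0⟩ y ⟨hy, hy0⟩
  obtain ⟨t, rfl⟩ := hs x hx
  obtain ⟨u, rfl⟩ := hs y hy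
  rw [Set.mem_preimage, Set.mem_singleton_iff, affineMap_smul_vadd_eq_mul g hv,
    mul_eq_zero_iff_right hv, sub_eq_zero] at hx0 hy0
  rw [hx0, hy0]

variable [LinearOrder 𝕜] [IsStrictOrderedRing 𝕜]

lemma pos_of_mul_pos_iff {a b : 𝕜} (hab : a * b ≠ 0) (hb : 0 < a * b ↔ 0 < b) : 0 < a := by
  by_contra! ha
  rcases le_or_gt b 0 with hb0 | hb0
  · exact hb0.not_gt (hb.1 (hab.symm.lt_of_le (mul_nonneg_of_nonpos_of_nonpos ha hb0)))
  · exact (mul_nonpos_of_nonpos_of_nonneg ha hb0.le).not_gt (hb.2 hb0)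

lemma exists_mem_eq_zero_of_neg_of_pos {C : Set E} (hC : Convex 𝕜 C) (g : E →ᵃ[𝕜] 𝕜) {x y : E}
    (hx : x ∈ C) (hy : y ∈ C) (hgx : g x < 0) (hgy : 0 < g y) : ∃ z ∈ C, g z = 0 :=
  (hC.affine_image g).ordConnected.out (Set.mem_image_of_mem g hx) (Set.mem_image_of_mem g hy)
    ⟨hgx.le, hgy.le⟩

end AffineGeometry

section SignCell

variable {ι 𝕜 E : Type*} [Field 𝕜] [LinearOrder 𝕜] [AddCommGroup E] [Module 𝕜 E]

/-- The open cell on which `f j`, for `j ∈ J`, is positive if `j ∈ σ` and negative otherwise: the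
sign vector of a cell is encoded by its set `σ` of positive indices. -/
def signCell (f : ι → E →ᵃ[𝕜] 𝕜) (J σ : Finset ι) : Set E :=
  {x | ∀ j ∈ J, f j x ≠ 0 ∧ (0 < f j x ↔ j ∈ σ)}

variable {f : ι → E →ᵃ[𝕜] 𝕜} {I J σ τ : Finset ι} {h i j : ι} {s K : Set E} {x y z : E}

lemma signCell_anti (hJ : J ⊆ I) : signCell f I σ ⊆ signCell f J σ := fun _ hx j hj => hx j (hJ hj)

lemma neg_of_mem_signCell (hx : x ∈ signCell f J σ) (hj : j ∈ J) (hjσ : j ∉ σ) : f j x < 0 :=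
  lt_of_le_of_ne (not_lt.1 fun hpos => hjσ ((hx j hj).2.1 hpos)) (hx j hj).1

lemma signCell_congr (hστ : ∀ j ∈ J, j ∈ σ ↔ j ∈ τ) : signCell f J σ = signCell f J τ :=
  Set.ext fun _ => forall₂_congr fun j hj => by rw [hστ j hj]

lemma eq_of_mem_signCell (hσ : σ ⊆ I) (hτ : τ ⊆ I) (hx : x ∈ signCell f I σ)
    (hy : y ∈ signCell f I τ) (hxy : ∀ j ∈ I, 0 < f j x ↔ 0 < f j y) : σ = τ := by
  ext j
  by_cases hj : j ∈ I
  · rw [← (hx j hj).2, hxy j hj, (hy j hj).2]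
  · exact iff_of_false (fun h => hj (hσ h)) fun h => hj (hτ h)

lemma convex_signCell [IsStrictOrderedRing 𝕜] : Convex 𝕜 (signCell f J σ) := by
  have hhalf : ∀ j, Convex 𝕜 {x | f j x ≠ 0 ∧ (0 < f j x ↔ j ∈ σ)} := fun j => by
    by_cases hj : j ∈ σ
    · have hset : {x | f j x ≠ 0 ∧ (0 < f j x ↔ j ∈ σ)} = f j ⁻¹' Set.Ioi 0 := by
        ext x
        simpa [hj] using ne_of_gt
      exact hset ▸ (convex_Ioi 0).affine_preimage (f j)
    · have hset : {x | f j x ≠ 0 ∧ (0 < f j x ↔ j ∈ σ)} = f j ⁻¹' Set.Iio 0 := by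
        ext x
        exact ⟨fun hx => lt_of_le_of_ne (not_lt.1 fun hpos => hj (hx.2.1 hpos)) hx.1,
          fun hx => ⟨ne_of_lt hx, iff_of_false (not_lt_of_gt hx) hj⟩⟩
      exact hset ▸ (convex_Iio 0).affine_preimage (f j)
  simpa only [signCell, Set.ofPred_forall] using convex_iInter₂ fun j _ => hhalf j

lemma convex_inter_preimage_zero [IsStrictOrderedRing 𝕜] (hs : Convex 𝕜 s) (g : E →ᵃ[𝕜] 𝕜) :
    Convex 𝕜 (s ∩ g ⁻¹' {0}) :=
  hs.inter ((convex_singleton 0).affine_preimage g)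

variable [DecidableEq ι]

lemma signCell_erase (hh : h ∉ J) : signCell f J (σ.erase h) = signCell f J σ :=
  signCell_congr fun j hj => by simp [ne_of_mem_of_not_mem hj hh]

lemma signCell_insert (hh : h ∉ J) : signCell f J (insert h σ) = signCell f J σ :=
  signCell_congr fun j hj => by simp [ne_of_mem_of_not_mem hj hh]

lemma exists_mem_signCell_eq_zero [IsStrictOrderedRing 𝕜] (hs : Convex 𝕜 s) (hh : h ∈ I)
    (hJ : J ⊆ I) (hhJ : h ∉ J) (hσ : h ∉ σ) (hneg : (s ∩ signCell f I σ).Nonempty)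
    (hpos : (s ∩ signCell f I (insert h σ)).Nonempty) :
    (s ∩ f h ⁻¹' {0} ∩ signCell f J σ).Nonempty := by
  obtain ⟨x, hxs, hx⟩ := hneg
  obtain ⟨y, hys, hy⟩ := hpos
  have hyJ : y ∈ signCell f J σ := by
    rw [← signCell_insert hhJ]
    exact signCell_anti hJ hy
  obtain ⟨z, ⟨hzs, hzσ⟩, hz⟩ := exists_mem_eq_zero_of_neg_of_pos (hs.inter convex_signCell) (f h)
    ⟨hxs, signCell_anti hJ hx⟩ ⟨hys, hyJ⟩ (neg_of_mem_signCell hx hh hσ)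
    ((hy h hh).2.2 (Finset.mem_insert_self h σ))
  exact ⟨z, ⟨hzs, hz⟩, hzσ⟩

end SignCell

section Zone

variable {ι 𝕜 E : Type*} [Field 𝕜] [LinearOrder 𝕜] [AddCommGroup E] [Module 𝕜 E]

open Classical in
/-- The sign vectors, encoded as in `signCell`, of the cells of the arrangement of the hyperplanes
`f i = 0`, `i ∈ I`, that meet `s`. -/
noncomputable def signFamily (f : ι → E →ᵃ[𝕜] 𝕜) (I : Finset ι) (s : Set E) : Finset (Finset ι) :=
  {σ ∈ I.powerset | (s ∩ signCell f I σ).Nonempty}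

variable {f : ι → E →ᵃ[𝕜] 𝕜} {I : Finset ι} {σ : Finset ι} {h i : ι} {s K : Set E}

lemma mem_signFamily : σ ∈ signFamily f I s ↔ σ ⊆ I ∧ (s ∩ signCell f I σ).Nonempty := by
  simp [signFamily]

lemma injOn_signCell : Set.InjOn (signCell f I) (signFamily f I s) := by
  intro σ hσ τ hτ heq
  obtain ⟨hσI, x, -, hx⟩ := mem_signFamily.1 hσ
  exact eq_of_mem_signCell hσI (mem_signFamily.1 hτ).1 hx (heq ▸ hx) fun _ _ => Iff.rfl

lemma card_signFamily_le_one
    (hs : ∀ x ∈ s, ∀ y ∈ s, ∀ j ∈ I, f j x ≠ 0 → f j y ≠ 0 → (0 < f j x ↔ 0 < f j y)) :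
    #(signFamily f I s) ≤ 1 := by
  refine Finset.card_le_one.2 fun σ hσ τ hτ => ?_
  obtain ⟨hσI, x, hxs, hx⟩ := mem_signFamily.1 hσ
  obtain ⟨hτI, y, hys, hy⟩ := mem_signFamily.1 hτ
  exact eq_of_mem_signCell hσI hτI hx hy fun j hj =>
    hs x hxs y hys j hj (hx j hj).1 (hy j hj).1

lemma card_signFamily_le_one_of_parallel {v p : E} (hs : ∀ x ∈ s, ∃ t : 𝕜, x = t • v +ᵥ p)
    (hpar : ∀ i ∈ I, (f i).linear v = 0) : #(signFamily f I s) ≤ 1 := by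
  refine card_signFamily_le_one fun x hx y hy j hj _ _ => ?_
  obtain ⟨t, rfl⟩ := hs x hx
  obtain ⟨u, rfl⟩ := hs y hy
  simp only [AffineMap.map_vadd, map_smul, hpar j hj, smul_zero]

variable [DecidableEq ι]

/-- The facet, on the hyperplane `f i = 0`, of the cell of `K` with sign vector `σ`; empty if the
cell has no such facet. -/
def facet (f : ι → E →ᵃ[𝕜] 𝕜) (I : Finset ι) (K : Set E) (σ : Finset ι) (i : ι) : Set E :=
  K ∩ f i ⁻¹' {0} ∩ signCell f (I.erase i) σ

open Classical in
/-- The sign vectors of the cells in the zone of `s` that have, within `K`, a facet on the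
hyperplane `f i = 0`. Summing the cardinalities over `i` gives the size of the zone. -/
noncomputable def zoneFamily (f : ι → E →ᵃ[𝕜] 𝕜) (I : Finset ι) (s K : Set E) (i : ι) :
    Finset (Finset ι) :=
  {σ ∈ signFamily f I s | (facet f I K σ i).Nonempty}

lemma mem_zoneFamily :
    σ ∈ zoneFamily f I s K i ↔ σ ∈ signFamily f I s ∧ (facet f I K σ i).Nonempty := by
  simp [zoneFamily]

lemma zoneFamily_subset_signFamily : zoneFamily f I s K i ⊆ signFamily f I s :=
  fun _ hσ => (mem_zoneFamily.1 hσ).1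

lemma sum_card_zoneFamily_eq_zero_or :
    ∑ i ∈ I, #(zoneFamily f I s K i) = 0 ∨ ∀ h ∈ I, ∃ x ∈ s, f h x ≠ 0 := by
  rcases (signFamily f I s).eq_empty_or_nonempty with hempty | ⟨σ, hσ⟩
  · exact .inl <| Finset.sum_eq_zero fun i _ => Finset.card_eq_zero.2 <|
      Finset.subset_empty.1 (hempty ▸ zoneFamily_subset_signFamily)
  · obtain ⟨-, x, hxs, hx⟩ := mem_signFamily.1 hσ
    exact .inr fun h hh => ⟨x, hxs, (hx h hh).1⟩

lemma card_zoneFamily_le_two_pow : #(zoneFamily f I s K i) ≤ 2 ^ #I := by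
  rw [← Finset.card_powerset]
  exact Finset.card_le_card fun σ hσ =>
    Finset.mem_powerset.2 (mem_signFamily.1 (zoneFamily_subset_signFamily hσ)).1

open Classical in
lemma sum_card_zoneFamily_eq_sum_card_facet :
    ∑ i ∈ I, #(zoneFamily f I s K i) =
      ∑ σ ∈ signFamily f I s, #{i ∈ I | (facet f I K σ i).Nonempty} :=
  (Finset.sum_card_bipartiteAbove_eq_sum_card_bipartiteBelow
    fun σ i => (facet f I K σ i).Nonempty).symm

section Deletion

lemma erase_mem_signFamily (hσ : σ ∈ signFamily f I s) :
    σ.erase h ∈ signFamily f (I.erase h) s := by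
  obtain ⟨hσI, x, hxs, hx⟩ := mem_signFamily.1 hσ
  refine mem_signFamily.2 ⟨Finset.erase_subset_erase h hσI, x, hxs, ?_⟩
  rw [signCell_erase (Finset.notMem_erase h I)]
  exact signCell_anti (Finset.erase_subset h I) hx

lemma erase_mem_zoneFamily (hσ : σ ∈ zoneFamily f I s K i) :
    σ.erase h ∈ zoneFamily f (I.erase h) s K i := by
  obtain ⟨hσ, y, hyK, hy⟩ := mem_zoneFamily.1 hσ
  refine mem_zoneFamily.2 ⟨erase_mem_signFamily hσ, y, hyK, ?_⟩
  rw [signCell_erase (by simp)]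
  exact signCell_anti (Finset.erase_subset_erase i (Finset.erase_subset h I)) hy

variable [IsStrictOrderedRing 𝕜]

lemma mem_signFamily_of_insert_mem (hs : Convex 𝕜 s) (hh : h ∈ I) (hhσ : h ∉ σ)
    (hneg : σ ∈ signFamily f I s) (hpos : insert h σ ∈ signFamily f I s) :
    σ ∈ signFamily f (I.erase h) (s ∩ f h ⁻¹' {0}) := by
  rw [mem_signFamily] at hneg hpos
  exact mem_signFamily.2 ⟨Finset.subset_erase.2 ⟨hneg.1, hhσ⟩, exists_mem_signCell_eq_zero hs hh
    (Finset.erase_subset h I) (Finset.notMem_erase h I) hhσ hneg.2 hpos.2⟩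

lemma mem_zoneFamily_of_insert_mem (hs : Convex 𝕜 s) (hK : Convex 𝕜 K) (hh : h ∈ I) (hih : i ≠ h)
    (hhσ : h ∉ σ) (hneg : σ ∈ zoneFamily f I s K i) (hpos : insert h σ ∈ zoneFamily f I s K i) :
    σ ∈ zoneFamily f (I.erase h) (s ∩ f h ⁻¹' {0}) (K ∩ f h ⁻¹' {0}) i := by
  rw [mem_zoneFamily] at hneg hpos
  refine mem_zoneFamily.2 ⟨mem_signFamily_of_insert_mem hs hh hhσ hneg.1 hpos.1, ?_⟩
  rw [facet, Set.inter_right_comm K]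
  exact exists_mem_signCell_eq_zero (convex_inter_preimage_zero hK (f i))
    (Finset.mem_erase.2 ⟨hih.symm, hh⟩) (Finset.erase_subset_erase i (Finset.erase_subset h I))
    (by simp) hhσ hneg.2 hpos.2

lemma card_zoneFamily_le (hs : Convex 𝕜 s) (hK : Convex 𝕜 K) (hh : h ∈ I) (hih : i ≠ h) :
    #(zoneFamily f I s K i) ≤ #(zoneFamily f (I.erase h) s K i) +
      #(zoneFamily f (I.erase h) (s ∩ f h ⁻¹' {0}) (K ∩ f h ⁻¹' {0}) i) :=
  card_le_card_add_card_of_erase_of_insert h (fun _ => erase_mem_zoneFamily)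
    fun _ hneg hhσ hpos => mem_zoneFamily_of_insert_mem hs hK hh hih hhσ hneg hpos

end Deletion

section Point

variable [IsStrictOrderedRing 𝕜]

lemma not_wbtw_of_mem_facet {a b c : ι} {x y z : E} (hab : a ≠ b) (hcb : c ≠ b) (hb : b ∈ I)
    (hx : x ∈ facet f I K σ a) (hy : y ∈ facet f I K σ b) (hz : z ∈ facet f I K σ c) :
    ¬ Wbtw 𝕜 x y z := by
  have hmem : ∀ {i w}, i ≠ b → w ∈ facet f I K σ i → w ∈ signCell f {b} σ := fun hib hw =>
    signCell_anti (by simp [hib.symm, hb]) hw.2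
  intro hxyz
  have hyb : y ∈ signCell f {b} σ :=
    convex_signCell.segment_subset (hmem hab hx) (hmem hcb hz) (mem_segment_iff_wbtw.2 hxyz)
  exact (hyb b (Finset.mem_singleton_self b)).1 hy.1.2

open Classical in
lemma card_facet_le_two (hK : Collinear 𝕜 K) : #{i ∈ I | (facet f I K σ i).Nonempty} ≤ 2 := by
  by_contra! hcard
  obtain ⟨a, ha, b, hb, c, hc, hab, hac, hbc⟩ := Finset.two_lt_card.1 hcard
  obtain ⟨haI, x, hx⟩ := Finset.mem_filter.1 ha
  obtain ⟨hbI, y, hy⟩ := Finset.mem_filter.1 hb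
  obtain ⟨hcI, z, hz⟩ := Finset.mem_filter.1 hc
  have hxyz : Collinear 𝕜 {x, y, z} := hK.subset <| by
    rintro w (rfl | rfl | rfl)
    exacts [hx.1.1, hy.1.1, hz.1.1]
  rcases hxyz.wbtw_or_wbtw_or_wbtw with hy_mid | hz_mid | hx_mid
  · exact not_wbtw_of_mem_facet hab hbc.symm hbI hx hy hz hy_mid
  · exact not_wbtw_of_mem_facet hbc hac hcI hy hz hx hz_mid
  · exact not_wbtw_of_mem_facet hac.symm hab.symm haI hz hx hy hx_mid

lemma sum_card_zoneFamily_le_two (hs : s.Subsingleton) (hK : Collinear 𝕜 K) :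
    ∑ i ∈ I, #(zoneFamily f I s K i) ≤ 2 := by
  have hcell : #(signFamily f I s) ≤ 1 :=
    card_signFamily_le_one fun x hx y hy j _ _ _ => by rw [hs hx hy]
  calc ∑ i ∈ I, #(zoneFamily f I s K i)
      ≤ #(signFamily f I s) • 2 := by
        rw [sum_card_zoneFamily_eq_sum_card_facet]
        exact Finset.sum_le_card_nsmul _ _ _ fun σ _ => card_facet_le_two hK
    _ ≤ 2 := by lia

end Point

section Line

/-- The members `σ` of `zoneFamily f I s K i` whose cell lies ahead of the hyperplane `f i = 0` when
one moves in the direction `v`. Hyperplanes parallel to `v` impose no condition, which lets the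
induction for `sum_card_forwardZoneFamily_le` treat them along with the others. -/
noncomputable def forwardZoneFamily (f : ι → E →ᵃ[𝕜] 𝕜) (v : E) (I : Finset ι) (s K : Set E)
    (i : ι) : Finset (Finset ι) :=
  {σ ∈ zoneFamily f I s K i | (f i).linear v ≠ 0 → (i ∈ σ ↔ 0 < (f i).linear v)}

variable {v p : E}

lemma mem_forwardZoneFamily :
    σ ∈ forwardZoneFamily f v I s K i ↔
      σ ∈ zoneFamily f I s K i ∧ ((f i).linear v ≠ 0 → (i ∈ σ ↔ 0 < (f i).linear v)) :=
  Finset.mem_filter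

lemma forwardZoneFamily_subset_signFamily : forwardZoneFamily f v I s K i ⊆ signFamily f I s :=
  (Finset.filter_subset _ _).trans zoneFamily_subset_signFamily

variable [IsStrictOrderedRing 𝕜]

lemma zoneFamily_subset_forward_union_backward :
    zoneFamily f I s K i ⊆ forwardZoneFamily f v I s K i ∪ forwardZoneFamily f (-v) I s K i := by
  intro σ hσ
  rw [Finset.mem_union, mem_forwardZoneFamily, mem_forwardZoneFamily, map_neg]
  grind

lemma card_forwardZoneFamily_le (hs : Convex 𝕜 s) (hK : Convex 𝕜 K) (hh : h ∈ I) (hih : i ≠ h) :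
    #(forwardZoneFamily f v I s K i) ≤ #(forwardZoneFamily f v (I.erase h) s K i) +
      #(zoneFamily f (I.erase h) (s ∩ f h ⁻¹' {0}) (K ∩ f h ⁻¹' {0}) i) := by
  refine card_le_card_add_card_of_erase_of_insert h (fun σ hσ => ?_) fun σ hneg hhσ hpos => ?_
  · rw [mem_forwardZoneFamily] at hσ ⊢
    exact ⟨erase_mem_zoneFamily hσ.1, by simpa [hih] using hσ.2⟩
  · exact mem_zoneFamily_of_insert_mem hs hK hh hih hhσ (mem_forwardZoneFamily.1 hneg).1
      (mem_forwardZoneFamily.1 hpos).1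

/-- Only the last cell met by a directed line lies ahead of the last hyperplane crossed. -/
lemma card_forwardZoneFamily_last_le_one (hs : ∀ x ∈ s, ∃ t : 𝕜, x = t • v +ᵥ p) (hh : h ∈ I)
    (hhv : (f h).linear v ≠ 0)
    (hlast : ∀ i ∈ I, (f i).linear v ≠ 0 →
      -f i p / (f i).linear v ≤ -f h p / (f h).linear v) :
    #(forwardZoneFamily f v I s K h) ≤ 1 := by
  have hpos : ∀ σ ∈ forwardZoneFamily f v I s K h, σ ⊆ I ∧ ∃ x ∈ signCell f I σ,
      ∀ j ∈ I, 0 < f j x ↔ 0 < (f j).linear v ∨ (f j).linear v = 0 ∧ 0 < f j p := by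
    intro σ hσ
    obtain ⟨hσ, hforward⟩ := mem_forwardZoneFamily.1 hσ
    obtain ⟨hσI, x, hxs, hx⟩ := mem_signFamily.1 (zoneFamily_subset_signFamily hσ)
    obtain ⟨t, rfl⟩ := hs x hxs
    have hsign := hx h hh
    have ht : -f h p / (f h).linear v < t := by
      rw [hforward hhv, affineMap_smul_vadd_eq_mul _ hhv] at hsign
      exact sub_pos.1 (pos_of_mul_pos_iff hsign.1 hsign.2)
    refine ⟨hσI, _, hx, fun j hj => ?_⟩
    by_cases hjv : (f j).linear v = 0
    · simp [-vadd_eq_add, hjv]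
    · have := sub_pos.2 ((hlast j hj hjv).trans_lt ht)
      simp [-vadd_eq_add, affineMap_smul_vadd_eq_mul _ hjv, mul_pos_iff_of_pos_left this, hjv]
  refine Finset.card_le_one.2 fun σ hσ τ hτ => ?_
  obtain ⟨hσI, x, hx, hx_pos⟩ := hpos σ hσ
  obtain ⟨hτI, y, hy, hy_pos⟩ := hpos τ hτ
  exact eq_of_mem_signCell hσI hτI hx hy fun j hj => (hx_pos j hj).trans (hy_pos j hj).symm

lemma sum_card_forwardZoneFamily_le (hs : Convex 𝕜 s) (hK : Convex 𝕜 K)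
    (hline : ∀ x ∈ s, ∃ t : 𝕜, x = t • v +ᵥ p)
    (hcol : ∀ h ∈ I, Collinear 𝕜 (K ∩ f h ⁻¹' {0} : Set E)) :
    ∑ i ∈ I, #(forwardZoneFamily f v I s K i) ≤ 3 * #I := by
  induction I using Finset.strongInduction with | H I ih
  by_cases hpar : ∀ i ∈ I, (f i).linear v = 0
  · calc ∑ i ∈ I, #(forwardZoneFamily f v I s K i)
        ≤ #I • 1 := Finset.sum_le_card_nsmul _ _ _ fun i _ =>
          (Finset.card_le_card forwardZoneFamily_subset_signFamily).trans
            (card_signFamily_le_one_of_parallel hline hpar)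
      _ ≤ 3 * #I := by lia
  push Not at hpar
  obtain ⟨j, hj, hjv⟩ := hpar
  obtain ⟨h, hh, hlast⟩ := Finset.exists_max_image {i ∈ I | (f i).linear v ≠ 0}
    (fun i => -f i p / (f i).linear v) ⟨j, Finset.mem_filter.2 ⟨hj, hjv⟩⟩
  obtain ⟨hhI, hhv⟩ := Finset.mem_filter.1 hh
  have hlast_le : #(forwardZoneFamily f v I s K h) ≤ 1 :=
    card_forwardZoneFamily_last_le_one hline hhI hhv fun i hi hiv =>
      hlast i (Finset.mem_filter.2 ⟨hi, hiv⟩)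
  have hdeleted : ∑ i ∈ I.erase h, #(forwardZoneFamily f v (I.erase h) s K i) ≤ 3 * #(I.erase h) :=
    ih _ (Finset.erase_ssubset hhI) fun i hi => hcol i (Finset.mem_of_mem_erase hi)
  have hpoint : ∑ i ∈ I.erase h,
      #(zoneFamily f (I.erase h) (s ∩ f h ⁻¹' {0}) (K ∩ f h ⁻¹' {0}) i) ≤ 2 :=
    sum_card_zoneFamily_le_two (subsingleton_inter_preimage_zero hhv hline) (hcol h hhI)
  calc ∑ i ∈ I, #(forwardZoneFamily f v I s K i)
      = ∑ i ∈ I.erase h, #(forwardZoneFamily f v I s K i) + #(forwardZoneFamily f v I s K h) :=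
        (Finset.sum_erase_add _ _ hhI).symm
    _ ≤ ∑ i ∈ I.erase h, (#(forwardZoneFamily f v (I.erase h) s K i) +
          #(zoneFamily f (I.erase h) (s ∩ f h ⁻¹' {0}) (K ∩ f h ⁻¹' {0}) i)) + 1 := by
        gcongr with i hi
        exact card_forwardZoneFamily_le hs hK hhI (Finset.ne_of_mem_erase hi)
    _ ≤ 3 * #(I.erase h) + 2 + 1 := by
        rw [Finset.sum_add_distrib]
        gcongr
    _ = 3 * #I := by rw [← Finset.card_erase_add_one hhI]; ring

lemma sum_card_zoneFamily_le_of_collinear (hs : Convex 𝕜 s) (hK : Convex 𝕜 K)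
    (hline : Collinear 𝕜 s) (hcol : ∀ h ∈ I, Collinear 𝕜 (K ∩ f h ⁻¹' {0} : Set E)) :
    ∑ i ∈ I, #(zoneFamily f I s K i) ≤ 6 * #I := by
  obtain ⟨p, v, hpv⟩ := (collinear_iff_exists_forall_eq_smul_vadd s).1 hline
  have hpv_neg : ∀ x ∈ s, ∃ t : 𝕜, x = t • -v +ᵥ p := fun x hx => by
    obtain ⟨t, rfl⟩ := hpv x hx
    exact ⟨-t, by rw [neg_smul_neg]⟩
  calc ∑ i ∈ I, #(zoneFamily f I s K i)
      ≤ ∑ i ∈ I, (#(forwardZoneFamily f v I s K i) + #(forwardZoneFamily f (-v) I s K i)) := by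
        gcongr
        exact (Finset.card_le_card zoneFamily_subset_forward_union_backward).trans
          (Finset.card_union_le _ _)
    _ ≤ 3 * #I + 3 * #I := by
        rw [Finset.sum_add_distrib]
        gcongr
        exacts [sum_card_forwardZoneFamily_le hs hK hpv hcol,
          sum_card_forwardZoneFamily_le hs hK hpv_neg hcol]
    _ = 6 * #I := by ring

end Line

section Averaging

variable [IsStrictOrderedRing 𝕜]

/-- Each of the `#I - 1` hyperplanes other than `f i = 0` can serve as the deleted one. -/
lemma card_sub_one_mul_sum_card_zoneFamily_le (hs : Convex 𝕜 s) (hK : Convex 𝕜 K) :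
    (#I - 1) * ∑ i ∈ I, #(zoneFamily f I s K i) ≤
      ∑ h ∈ I, (∑ i ∈ I.erase h, #(zoneFamily f (I.erase h) s K i) +
        ∑ i ∈ I.erase h,
          #(zoneFamily f (I.erase h) (s ∩ f h ⁻¹' {0}) (K ∩ f h ⁻¹' {0}) i)) := by
  rw [← smul_eq_mul, ← sum_sum_erase]
  gcongr with h hh
  rw [← Finset.sum_add_distrib]
  gcongr with i hi
  exact card_zoneFamily_le hs hK hh (Finset.ne_of_mem_erase hi)

lemma sum_card_zoneFamily_le_mul_pow_add_two {c e : ℕ} (hc : 2 ≤ c) (hs : Convex 𝕜 s)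
    (hK : Convex 𝕜 K)
    (hsection : ∀ h ∈ I, ∀ J ⊆ I.erase h,
      ∑ i ∈ J, #(zoneFamily f J (s ∩ f h ⁻¹' {0}) (K ∩ f h ⁻¹' {0}) i) ≤ c * #J ^ (e + 1)) :
    ∑ i ∈ I, #(zoneFamily f I s K i) ≤ c * #I ^ (e + 2) := by
  induction hn : #I generalizing I with
  | zero => simp [Finset.card_eq_zero.1 hn]
  | succ n ih =>
    rcases n.eq_zero_or_pos with rfl | hpos
    · obtain ⟨i, rfl⟩ := Finset.card_eq_one.1 hn
      simpa using (card_zoneFamily_le_two_pow (i := i)).trans (by simpa using hc)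
    refine Nat.le_of_mul_le_mul_left ?_ hpos
    have hcard : ∀ h ∈ I, #(I.erase h) = n := fun h hh => by
      rw [Finset.card_erase_of_mem hh, hn, Nat.add_sub_cancel]
    calc n * ∑ i ∈ I, #(zoneFamily f I s K i)
        ≤ ∑ _h ∈ I, (c * n ^ (e + 2) + c * n ^ (e + 1)) := by
          have havg := card_sub_one_mul_sum_card_zoneFamily_le (f := f) (I := I) hs hK
          rw [hn, Nat.add_sub_cancel] at havg
          refine havg.trans ?_
          gcongr with _ hh
          · refine ih (fun i hi J hJ => ?_) (hcard _ hh)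
            exact hsection i (Finset.mem_of_mem_erase hi) J
              (hJ.trans (Finset.erase_subset_erase i (Finset.erase_subset _ I)))
          · exact hcard _ hh ▸ hsection _ hh _ subset_rfl
      _ = n * (c * ((n + 1) ^ 2 * n ^ e)) := by
          rw [Finset.sum_const, hn, smul_eq_mul]
          ring
      _ ≤ n * (c * ((n + 1) ^ 2 * (n + 1) ^ e)) := by
          gcongr
          exact n.le_succ
      _ = n * (c * (n + 1) ^ (e + 2)) := by ring

end Averaging

theorem sum_card_zoneFamily_le [IsStrictOrderedRing 𝕜] [FiniteDimensional 𝕜 E] (d : ℕ)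
    (hs : Convex 𝕜 s) (hK : Convex 𝕜 K) (hsK : s ⊆ K)
    (hsd : Module.finrank 𝕜 (vectorSpan 𝕜 s) ≤ d)
    (hKd : Module.finrank 𝕜 (vectorSpan 𝕜 K) ≤ d + 1) :
    ∑ i ∈ I, #(zoneFamily f I s K i) ≤ 6 * #I ^ d := by
  induction d using Nat.twoStepInduction generalizing I s K with
  | zero =>
    have hpoint : s.Subsingleton := by
      rw [← vectorSpan_eq_bot_iff_subsingleton 𝕜, ← Submodule.finrank_eq_zero]
      exact Nat.le_zero.1 hsd
    exact (sum_card_zoneFamily_le_two hpoint (collinear_iff_finrank_le_one.2 hKd)).trans (by simp)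
  | one =>
    rcases sum_card_zoneFamily_eq_zero_or (f := f) (I := I) (s := s) (K := K) with hzero | hne
    · exact hzero.trans_le (Nat.zero_le _)
    rw [pow_one]
    refine sum_card_zoneFamily_le_of_collinear hs hK (collinear_iff_finrank_le_one.2 hsd)
      fun h hh => ?_
    obtain ⟨x, hxs, hx⟩ := hne h hh
    exact collinear_iff_finrank_le_one.2
      (finrank_vectorSpan_inter_preimage_zero_le (hsK hxs) hx hKd)
  | more d _ ih =>
    rcases sum_card_zoneFamily_eq_zero_or (f := f) (I := I) (s := s) (K := K) with hzero | hne
    · exact hzero.trans_le (Nat.zero_le _)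
    refine sum_card_zoneFamily_le_mul_pow_add_two (by norm_num) hs hK fun h hh J _ => ?_
    obtain ⟨x, hxs, hx⟩ := hne h hh
    exact ih (convex_inter_preimage_zero hs (f h)) (convex_inter_preimage_zero hK (f h))
      (Set.inter_subset_inter_left _ hsK)
      (finrank_vectorSpan_inter_preimage_zero_le hxs hx hsd)
      (finrank_vectorSpan_inter_preimage_zero_le (hsK hxs) hx hKd)

end Zone

section Topology

variable {ι E : Type*} [AddCommGroup E] [Module ℝ E] [TopologicalSpace E]
variable {f : ι → E →ᵃ[ℝ] ℝ} {I J σ : Finset ι} {K : Set E} {x : E}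

lemma connectedComponentIn_eq_inter_signCell [IsTopologicalAddGroup E] [ContinuousSMul ℝ E]
    (hf : ∀ j ∈ J, Continuous (f j)) (hK : Convex ℝ K) (hx : x ∈ K ∩ signCell f J σ) :
    connectedComponentIn {y | y ∈ K ∧ ∀ j ∈ J, f j y ≠ 0} x = K ∩ signCell f J σ := by
  set X := {y | y ∈ K ∧ ∀ j ∈ J, f j y ≠ 0}
  have hcell : K ∩ signCell f J σ ⊆ X := fun y hy => ⟨hy.1, fun j hj => (hy.2 j hj).1⟩
  refine subset_antisymm (fun y hy => ?_)
    ((hK.inter convex_signCell).isPreconnected.subset_connectedComponentIn hx hcell)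
  have hsame : ∀ j ∈ J, ∀ a ∈ connectedComponentIn X x, ∀ b ∈ connectedComponentIn X x,
      0 < f j a → 0 < f j b := by
    intro j hj a ha b hb hpos
    by_contra! hnonpos
    obtain ⟨z, hz, hz0⟩ := isPreconnected_connectedComponentIn.intermediate_value hb ha
      (hf j hj).continuousOn ⟨hnonpos, hpos.le⟩
    exact (connectedComponentIn_subset X x hz).2 j hj hz0
  have hxx : x ∈ connectedComponentIn X x := mem_connectedComponentIn (hcell hx)
  refine ⟨(connectedComponentIn_subset X x hy).1, fun j hj =>
    ⟨(connectedComponentIn_subset X x hy).2 j hj, ?_⟩⟩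
  rw [← (hx.2 j hj).2]
  exact ⟨hsame j hj y hy x hxx, hsame j hj x hxx y hy⟩

lemma mem_signCell_of_mem_closure (hf : ∀ j ∈ J, Continuous (f j)) (hJ : J ⊆ I)
    (hx : x ∈ closure (signCell f I σ)) (hne : ∀ j ∈ J, f j x ≠ 0) : x ∈ signCell f J σ := by
  refine fun j hj => ⟨hne j hj, ?_⟩
  by_cases hjσ : j ∈ σ
  · have hnonneg : 0 ≤ f j x := closure_minimal (fun y hy => ((hy j (hJ hj)).2.2 hjσ).le)
      (isClosed_le continuous_const (hf j hj)) hx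
    exact iff_of_true (hnonneg.lt_of_ne' (hne j hj)) hjσ
  · have hnonpos : f j x ≤ 0 := closure_minimal
      (fun y hy => (neg_of_mem_signCell hy (hJ hj) hjσ).le)
      (isClosed_le (hf j hj) continuous_const) hx
    exact iff_of_false hnonpos.not_gt hjσ

end Topology

section Planes

lemma IsPlane.exists_affineMap_eq_zero_iff_mem {P : AffineSubspace ℝ E3} (hP : IsPlane P) :
    ∃ g : E3 →ᵃ[ℝ] ℝ, ∀ x, g x = 0 ↔ x ∈ P := by
  rw [IsPlane] at hP
  refine PlaneArrangement.exists_affineMap_eq_zero_iff_mem ?_ ?_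
  · rw [Set.nonempty_iff_ne_empty, Ne, AffineSubspace.coe_eq_bot_iff]
    rintro rfl
    rw [AffineSubspace.direction_bot, finrank_bot] at hP
    exact two_ne_zero hP.symm
  · rw [hP, finrank_euclideanSpace_fin]

variable {A : Finset (AffineSubspace ℝ E3)} {P S : AffineSubspace ℝ E3} {x : E3}
variable {f : AffineSubspace ℝ E3 → E3 →ᵃ[ℝ] ℝ} {σ : Finset (AffineSubspace ℝ E3)}

lemma connectedComponentIn_complementSet (hf : ∀ P ∈ A, ∀ x, f P x = 0 ↔ x ∈ P)
    (hx : x ∈ signCell f A σ) : connectedComponentIn (complementSet A) x = signCell f A σ := by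
  have hset : complementSet A = {y | y ∈ Set.univ ∧ ∀ P ∈ A, f P y ≠ 0} := by
    ext y
    simp +contextual [complementSet, hf]
  rw [hset, connectedComponentIn_eq_inter_signCell
    (fun P _ => (f P).continuous_of_finiteDimensional) convex_univ ⟨trivial, hx⟩, Set.univ_inter]

lemma mem_signCell_filter_pos (hf : ∀ P ∈ A, ∀ x, f P x = 0 ↔ x ∈ P) (hx : x ∈ complementSet A) :
    x ∈ signCell f A {P ∈ A | 0 < f P x} :=
  fun P hP => ⟨(hf P hP x).not.2 (hx P hP), by simp [hP]⟩

lemma zone_eq_image_signFamily (hf : ∀ P ∈ A, ∀ x, f P x = 0 ↔ x ∈ P) :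
    zone A S = signCell f A '' (signFamily f A (S : Set E3)) := by
  ext C
  constructor
  · rintro ⟨⟨x, hx, rfl⟩, y, hyC, hyS⟩
    rw [connectedComponentIn_complementSet hf (mem_signCell_filter_pos hf hx)] at hyC ⊢
    exact Set.mem_image_of_mem _ (mem_signFamily.2 ⟨Finset.filter_subset _ _, y, hyS, hyC⟩)
  · rintro ⟨σ, hσ, rfl⟩
    obtain ⟨-, x, hxS, hx⟩ := mem_signFamily.1 hσ
    exact ⟨⟨x, fun P hP hxP => (hx P hP).1 ((hf P hP x).2 hxP),
      (connectedComponentIn_complementSet hf hx).symm⟩, x, hx, hxS⟩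

variable [DecidableEq (AffineSubspace ℝ E3)]

lemma connectedComponentIn_planeComplement (hf : ∀ P ∈ A, ∀ x, f P x = 0 ↔ x ∈ P) (hP : P ∈ A)
    (hx : x ∈ facet f A Set.univ σ P) :
    connectedComponentIn (planeComplement A P) x = facet f A Set.univ σ P := by
  have hset : planeComplement A P =
      {y | y ∈ Set.univ ∩ f P ⁻¹' {0} ∧ ∀ Q ∈ A.erase P, f Q y ≠ 0} :=
    Set.ext fun y => and_congr (by simp [hf P hP])
      ⟨fun hy Q hQ => (hf Q (Finset.mem_of_mem_erase hQ) y).not.2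
        (hy Q (Finset.mem_of_mem_erase hQ) (Finset.ne_of_mem_erase hQ)),
      fun hy Q hQ hQP => (hf Q hQ y).not.1 (hy Q (Finset.mem_erase.2 ⟨hQP, hQ⟩))⟩
  rw [hset, connectedComponentIn_eq_inter_signCell
    (fun P _ => (f P).continuous_of_finiteDimensional)
    (convex_inter_preimage_zero convex_univ _) hx, facet]

open Classical in
lemma facesOf_signCell_subset (hf : ∀ P ∈ A, ∀ x, f P x = 0 ↔ x ∈ P) :
    facesOf A (signCell f A σ) ⊆
      ({P ∈ A | (facet f A Set.univ σ P).Nonempty}.image (facet f A Set.univ σ) : Finset _) := by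
  rintro F ⟨⟨P, hP, x, hx, rfl⟩, hF⟩
  have hxσ : x ∈ signCell f (A.erase P) σ :=
    mem_signCell_of_mem_closure (fun Q _ => (f Q).continuous_of_finiteDimensional)
      (Finset.erase_subset P A) (frontier_subset_closure (hF (mem_connectedComponentIn hx)))
      fun Q hQ => (hf Q (Finset.mem_of_mem_erase hQ) x).not.2
        (hx.2 Q (Finset.mem_of_mem_erase hQ) (Finset.ne_of_mem_erase hQ))
  have hx_facet : x ∈ facet f A Set.univ σ P := ⟨⟨trivial, (hf P hP x).2 hx.1⟩, hxσ⟩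
  rw [connectedComponentIn_planeComplement hf hP hx_facet]
  exact Finset.mem_coe.2 (Finset.mem_image_of_mem _ (Finset.mem_filter.2 ⟨hP, x, hx_facet⟩))

lemma zoneSize_le (hf : ∀ P ∈ A, ∀ x, f P x = 0 ↔ x ∈ P) :
    zoneSize A S ≤ ∑ P ∈ A, #(zoneFamily f A (S : Set E3) Set.univ P) := by
  classical
  rw [zoneSize, zone_eq_image_signFamily hf, finsum_mem_image injOn_signCell,
    finsum_mem_coe_finset, sum_card_zoneFamily_eq_sum_card_facet]
  gcongr with σ
  calc (facesOf A (signCell f A σ)).ncard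
      ≤ #({P ∈ A | (facet f A Set.univ σ P).Nonempty}.image (facet f A Set.univ σ)) := by
        rw [← Set.ncard_coe_finset]
        exact Set.ncard_le_ncard (facesOf_signCell_subset hf) (Finset.finite_toSet _)
    _ ≤ #{P ∈ A | (facet f A Set.univ σ P).Nonempty} := Finset.card_image_le

end Planes

end PlaneArrangement

open PlaneArrangement in
theorem theorem2_general {A : Finset (AffineSubspace ℝ E3)} {S : AffineSubspace ℝ E3}
    (hA : ∀ P ∈ A, IsPlane P) (hS : Module.finrank ℝ S.direction ≤ 2) :
    (zone A S).Finite ∧ (∀ C ∈ zone A S, (facesOf A C).Finite) ∧ zoneSize A S ≤ 6 * #A ^ 2 := by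
  classical
  choose! f hf using fun P hP => (hA P hP).exists_affineMap_eq_zero_iff_mem
  refine ⟨?_, ?_, (zoneSize_le hf).trans ?_⟩
  · rw [zone_eq_image_signFamily hf]
    exact (Finset.finite_toSet _).image _
  · rw [zone_eq_image_signFamily hf]
    rintro _ ⟨σ, -, rfl⟩
    exact (Finset.finite_toSet _).subset (facesOf_signCell_subset hf)
  · refine sum_card_zoneFamily_le 2 S.convex convex_univ (Set.subset_univ _) ?_ ?_
    · rwa [← AffineSubspace.direction_eq_vectorSpan]
    · exact (Submodule.finrank_le _).trans finrank_euclideanSpace_fin.le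

theorem theorem2 :
    ∃ c : ℕ, ∀ (n : ℕ) (A : Finset (AffineSubspace ℝ PlaneArrangement.E3))
      (S : AffineSubspace ℝ PlaneArrangement.E3),
      A.card = n →
      (∀ P ∈ A, PlaneArrangement.IsPlane P) →
      PlaneArrangement.GeneralPosition A →
      PlaneArrangement.IsPlane S →
      S ∉ A →
      (PlaneArrangement.zone A S).Finite ∧
      (∀ C ∈ PlaneArrangement.zone A S, (PlaneArrangement.facesOf A C).Finite) ∧
      PlaneArrangement.zoneSize A S ≤ c * n ^ 2 :=
  ⟨6, fun _ _ _ hn hA _ hS _ => hn ▸ theorem2_general hA hS.le⟩
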